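/- Let $n$ be a positive odd integer and let $q$ be an indeterminate. Write $(a;q)_0=1$ and $(a;q)_k=(1-a)(1-aq)\cdots(1-aq^{k-1})$ for $k\ge 1$ for the $q$-shifted factorial, $[n]=1+q+\cdots+q^{n-1}$ for the $q$-integer, and $\Phi_n(q)$ for the $n$-th cyclotomic polynomial in $q$. For integers $k\ge 0$ put $$c_q(k)=[4k+1]\frac{(q;q^2)_k^4}{(q^2;q^2)_k^4}.$$ Then $$\sum_{k=0}^{n-1}\sum_{j=0}^{k}c_q(j)\,c_q(k-j)\equiv q^{1-n}[n]^2 \pmod{[n]\Phi_n(q)^3},$$ where two rational functions in $\mathbb{Q}(q)$ are called congruent modulo a polynomial $P(q)$ if $P(q)$ divides the numerator of their difference written in lowest terms. -/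

import Mathlib

/-- The `q`-shifted factorial `(a; q)_n = (1 - a) (1 - a q) ⋯ (1 - a q ^ (n - 1))`. -/
def qShiftedFactorial {R : Type*} [CommRing R] (a q : R) (n : ℕ) : R :=
  ∏ i ∈ Finset.range n, (1 - a * q ^ i)

/-- The `q`-integer `[n] = 1 + q + ⋯ + q ^ (n - 1)`. -/
def qInteger {R : Type*} [CommRing R] (q : R) (n : ℕ) : R :=
  ∑ i ∈ Finset.range n, q ^ i

/-- Congruence of rational functions in the indeterminate `q` modulo a polynomial `P`: the
numerator of `f - g`, written in lowest terms, is divisible by `P` (so that the reduced denominator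
of `f - g` is coprime to `P`). -/
def RatFuncCongr (P : Polynomial ℚ) (f g : RatFunc ℚ) : Prop :=
  P ∣ (f - g).num

/-- `c_q(k) = [4k+1] (q; q²)_k ^ 4 / (q²; q²)_k ^ 4`, a rational function in the
indeterminate `q`. -/
noncomputable def cTerm (k : ℕ) : RatFunc ℚ :=
  qInteger RatFunc.X (4 * k + 1) *
    qShiftedFactorial RatFunc.X (RatFunc.X ^ 2) k ^ 4 /
      qShiftedFactorial (RatFunc.X ^ 2) (RatFunc.X ^ 2) k ^ 4

open Finset

/-! The modulus splits as a product over the divisors d ≠ 1 of n of pairwise coprime factors: Φ_d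
for d < n and Φ_n^4 for d = n (`qInteger_mul_cyclotomic_cube`). Each factor is treated in the ring
of rational functions regular at a primitive d-th root of unity z, with d = 2m + 1.

For d < n, the values at z satisfy c(ad + b) = w(a) p(b) for 0 ≤ b < d, with p(b) = 0 for b > m.
Remainders that contribute are therefore added without carry, and the truncated Cauchy square
factors with (Σ p)^2 as a factor (`sum_conv_of_block`). The reflection k ↦ m - k gives Σ p = 0
(`clearedSum_eq_zero`).

For d = n, c(k) is divisible by Φ_n^4 for m < k < n, so the double sum is S^2 modulo Φ_n^4, where S
is the sum of c(k) over k ≤ m. It remains to show q^m S ≡ [n] modulo Φ_n^3 (`cyclotomic_cube_dvd`):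
both sides are divisible by Φ_n, so squaring gains one more power.

That congruence comes from deforming half of the factors by a parameter a. At a = q^n the deformed
sum is a terminating very-well-poised sum with a closed form (`sum_wpRatio`). The deformation enters
through w = (1 - a)^2, which Φ_n^2 divides at a = q^n. Modulo Φ_n, where q^n = 1, the cleared sum
vanishes identically in w by the same reflection, so passing from this w to w = 0 changes it by a
multiple of Φ_n^3. -/

/-! ### Truncated Cauchy squares of block-multiplicative sequences. -/

theorem sum_range_sum_range_sub_eq {R : Type*} [AddCommMonoid R] (f : ℕ → ℕ → R) (n : ℕ) :
    ∑ k ∈ range n, ∑ j ∈ range (k + 1), f j (k - j) =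
      ∑ i ∈ range n, ∑ j ∈ range n, if i + j < n then f i j else 0 := by
  simp_rw [← sum_filter]
  rw [sum_sigma', sum_sigma']
  refine sum_nbij' (fun p => ⟨p.2, p.1 - p.2⟩) (fun p => ⟨p.1 + p.2, p.1⟩) ?_ ?_ ?_ ?_ ?_
  · rintro ⟨a, b⟩ h
    simp only [mem_sigma, mem_range, mem_filter] at h ⊢
    omega
  · rintro ⟨a, b⟩ h
    simp only [mem_sigma, mem_range, mem_filter] at h ⊢
    omega
  · rintro ⟨a, b⟩ h
    simp only [mem_sigma, mem_range] at h ⊢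
    rw [Sigma.mk.injEq]
    exact ⟨by omega, HEq.rfl⟩
  · rintro ⟨a, b⟩ h
    simp
  · rintro ⟨a, b⟩ h
    rfl

theorem sum_range_mul_eq_sum_sum {R : Type*} [AddCommMonoid R] (f : ℕ → R) (M d : ℕ) :
    ∑ i ∈ range (M * d), f i = ∑ a ∈ range M, ∑ b ∈ range d, f (a * d + b) := by
  induction M with
  | zero => simp
  | succ M ih => rw [Nat.succ_mul, sum_range_add, ih, sum_range_succ]

/-- Partial sums of a Cauchy square, for a sequence that is multiplicative over blocks of length
`2 * m + 1` and whose blocks vanish in their second half. -/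
theorem sum_conv_of_block {R : Type*} [CommRing R] (e w p : ℕ → R) (m M : ℕ)
    (h : ∀ a < M, ∀ b < 2 * m + 1, e (a * (2 * m + 1) + b) = w a * p b)
    (hp : ∀ b, m < b → b < 2 * m + 1 → p b = 0) :
    ∑ k ∈ range (M * (2 * m + 1)), ∑ j ∈ range (k + 1), e j * e (k - j) =
      (∑ i ∈ range M, ∑ j ∈ range (i + 1), w j * w (i - j)) *
        (∑ b ∈ range (2 * m + 1), p b) ^ 2 := by
  rw [sum_range_sum_range_sub_eq (fun i j => e i * e j),
    sum_range_sum_range_sub_eq (fun i j => w i * w j), sum_range_mul_eq_sum_sum]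
  simp_rw [sum_range_mul_eq_sum_sum _ M, sum_mul, pow_two, sum_mul_sum, mul_sum]
  refine sum_congr rfl fun a ha => ?_
  rw [sum_comm]
  refine sum_congr rfl fun a' ha' => ?_
  refine sum_congr rfl fun b hb => ?_
  refine sum_congr rfl fun b' hb' => ?_
  rw [mem_range] at ha ha' hb hb'
  rw [h a ha b hb, h a' ha' b' hb']
  by_cases h1 : m < b
  · rw [hp b h1 hb]; simp
  by_cases h2 : m < b'
  · rw [hp b' h2 hb']; simp
  -- Both remainders are at most m, so b + b' < 2m + 1: no carry occurs and the truncation depends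
  -- on a + a' alone.
  have key : a * (2 * m + 1) + b + (a' * (2 * m + 1) + b') < M * (2 * m + 1) ↔ a + a' < M := by
    have e1 : a * (2 * m + 1) + b + (a' * (2 * m + 1) + b') =
      (b + b') + (a + a') * (2 * m + 1) := by ring
    rw [e1, ← Nat.div_lt_iff_lt_mul (by omega), Nat.add_mul_div_right _ _ (by omega),
      Nat.div_eq_of_lt (by omega), zero_add]
  simp only [key]
  split_ifs <;> ring

/-! ### The cleared sum and its vanishing at roots of unity. -/

theorem one_sub_mul_qInteger {R : Type*} [CommRing R] (q : R) (n : ℕ) :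
    (1 - q) * qInteger q n = 1 - q ^ n :=
  mul_neg_geom_sum q n

/-- `a (1 - u) ^ 2 - w u`, equal to `(1 - a u) (a - u)` for `w = (1 - a) ^ 2`. -/
def quadFactor {R : Type*} [CommRing R] (a w u : R) : R := a * (1 - u) ^ 2 - w * u

/-- The first `k` odd-exponent factors times the last `m - k` even-exponent factors. -/
def mixedProd {R : Type*} [CommRing R] (q a w : R) (m k : ℕ) : R :=
  (∏ i ∈ range k, quadFactor a w (q ^ (2 * i + 1))) *
    ∏ i ∈ Ico k m, quadFactor a w (q ^ (2 * i + 2))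

/-- The very-well-poised sum with denominators cleared. -/
def clearedSum {R : Type*} [CommRing R] (q a w : R) (m : ℕ) : R :=
  ∑ k ∈ range (m + 1), qInteger q (4 * k + 1) * mixedProd q 1 0 m k * mixedProd q a w m k

theorem quadFactor_reflect {R : Type*} [CommRing R] (w u v : R) (h : u * v = 1) :
    quadFactor 1 w u = quadFactor 1 w v * u ^ 2 := by
  unfold quadFactor
  linear_combination ((2 * u - u * v - 1 + w * u)) * h

/-- Since q^(2m+1) = 1, each odd-exponent factor reflects to an even-exponent one. The bracket that
results is symmetric under k ↦ m - k, and the asymmetry sits in the power of q. -/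
theorem mixedProd_of_pow_eq_one {R : Type*} [CommRing R] (q w : R) (m k : ℕ) (hk : k ≤ m)
    (hq : q ^ (2 * m + 1) = 1) :
    mixedProd q 1 w m k = q ^ (2 * k ^ 2) *
      ((∏ i ∈ Ico (m - k) m, quadFactor 1 w (q ^ (2 * i + 2))) *
        ∏ i ∈ Ico k m, quadFactor 1 w (q ^ (2 * i + 2))) := by
  unfold mixedProd
  rw [← mul_assoc]
  congr 1
  induction k with
  | zero => simp
  | succ k ih =>
    have hr := quadFactor_reflect w (q ^ (2 * k + 1)) (q ^ (2 * (m - (k + 1)) + 2))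
      (by rw [← pow_add, ← hq]; congr 1; omega)
    rw [prod_range_succ, ih (by omega), hr, prod_eq_prod_Ico_succ_bot (a := m - (k + 1)) (by omega),
      show m - (k + 1) + 1 = m - k by omega]
    ring

/-- After multiplication by 1 - q, the terms k and m - k cancel. Keeping w free is what later yields
divisibility of every coefficient in w. -/
theorem clearedSum_eq_zero {R : Type*} [CommRing R] [IsDomain R] [CharZero R] (q w : R) (m : ℕ)
    (hq : q ^ (2 * m + 1) = 1) (hq1 : q ≠ 1) : clearedSum q 1 w m = 0 := by
  have hne : (2 : R) * (1 - q) ≠ 0 := mul_ne_zero two_ne_zero (sub_ne_zero.2 hq1.symm)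
  refine (mul_eq_zero.1 ?_).resolve_left hne
  rw [mul_assoc, two_mul]
  have hr : clearedSum q 1 w m = _ := (sum_range_reflect _ _).symm
  nth_rewrite 1 [hr]
  rw [clearedSum, mul_sum, mul_sum, ← sum_add_distrib]
  refine sum_eq_zero fun k hk => ?_
  rw [mem_range] at hk
  rw [show m + 1 - 1 - k = m - k by omega, ← mul_assoc, ← mul_assoc, ← mul_assoc, ← mul_assoc,
    one_sub_mul_qInteger, one_sub_mul_qInteger]
  simp only [mixedProd_of_pow_eq_one _ _ m k (by omega) hq,
    mixedProd_of_pow_eq_one _ _ m (m - k) (by omega) hq, show m - (m - k) = k by omega]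
  have key : (1 - q ^ (4 * (m - k) + 1)) * (q ^ (2 * (m - k) ^ 2)) ^ 2 +
      (1 - q ^ (4 * k + 1)) * (q ^ (2 * k ^ 2)) ^ 2 = 0 := by
    obtain ⟨l, rfl⟩ := Nat.exists_eq_add_of_le (show k ≤ m by omega)
    rw [Nat.add_sub_cancel_left]
    have hpow (a b : ℕ) (h : a = (2 * (k + l) + 1) * b) : q ^ a = 1 := by
      rw [h, pow_mul, hq, one_pow]
    have h1 : (q ^ (2 * l ^ 2)) ^ 2 = (q ^ (2 * k ^ 2)) ^ 2 * q ^ (4 * k + 1) := by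
      -- Both sides are inverse to the same power of q, as 2l(2k+1) + 4l² and (2k+1)² + 2l(2k+1) are
      -- multiples of 2(k+l) + 1.
      refine left_inv_eq_right_inv (a := q ^ ((2 * k + 1) * (2 * l))) ?_ ?_
      · rw [← pow_mul, ← pow_add]
        exact hpow _ (2 * l) (by ring)
      · rw [← pow_mul, ← pow_add, ← pow_add]
        exact hpow _ (2 * k + 1) (by ring)
    have h2 : q ^ (4 * k + 1) * q ^ (4 * l + 1) = 1 := by
      rw [← pow_add]
      exact hpow _ 2 (by ring)
    rw [h1]
    linear_combination -(q ^ (2 * k ^ 2)) ^ 2 * h2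

  linear_combination
    ((∏ i ∈ Ico (m - k) m, quadFactor 1 w (q ^ (2 * i + 2))) *
      (∏ i ∈ Ico k m, quadFactor 1 w (q ^ (2 * i + 2))) *
      (∏ i ∈ Ico (m - k) m, quadFactor 1 0 (q ^ (2 * i + 2))) *
      (∏ i ∈ Ico k m, quadFactor 1 0 (q ^ (2 * i + 2)))) * key

theorem map_clearedSum {R S : Type*} [CommRing R] [CommRing S] (f : R →+* S) (q a w : R) (m : ℕ) :
    f (clearedSum q a w m) = clearedSum (f q) (f a) (f w) m := by
  simp [clearedSum, mixedProd, quadFactor, qInteger]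

/-! ### A terminating very-well-poised summation. -/

section Field

variable {K : Type*} [Field K]

/-- `∏_{i < k} (1 - q ^ (2 i + 1)) / (1 - q ^ (2 i + 2))`. -/
def qCentral (q : K) (k : ℕ) : K :=
  ∏ i ∈ range k, (1 - q ^ (2 * i + 1)) / (1 - q ^ (2 * i + 2))

/-- The ratio `(q² x, x⁻¹; q²)_k / (q³ x, q x⁻¹; q²)_k`. -/
def wpRatio (q x : K) (k : ℕ) : K :=
  ∏ i ∈ range k, ((1 - q ^ (2 * i + 2) * x) * (x - q ^ (2 * i))) /
    ((1 - q ^ (2 * i + 3) * x) * (x - q ^ (2 * i + 1)))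

/-- A common factor of `wpRatio q x` and `wpRatio q (q ^ 2 * x)`. -/
def wpCommon (q x : K) (k : ℕ) : K :=
  ∏ i ∈ range k, ((1 - q ^ (2 * i + 2) * x) * (q ^ 2 * x - q ^ (2 * i))) /
    ((1 - q ^ (2 * i + 5) * x) * (x - q ^ (2 * i + 1)))

variable {q x : K}

/-- The factors x - q^(2i+1) occur in both denominators and are never cancelled, so they need not be
nonzero. -/
theorem wpRatio_mul_eq (hx : ∀ i, 1 - q ^ (i + 1) * x ≠ 0) (k : ℕ) :
    wpRatio q x k * (q ^ (2 * k) * (q ^ 2 * x - 1) * (1 - q ^ 3 * x)) =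
      wpCommon q x k * ((q ^ 2 * x - q ^ (2 * k)) * (1 - q ^ (2 * k + 3) * x)) := by
  induction k with
  | zero => simp [wpRatio, wpCommon]
  | succ k ih =>
    rw [wpRatio, wpCommon, prod_range_succ, prod_range_succ, ← wpRatio, ← wpCommon,
      div_eq_mul_inv, div_eq_mul_inv, mul_inv, mul_inv]
    have e1 := mul_inv_cancel₀ (hx (2 * k + 2))
    have e2 := mul_inv_cancel₀ (hx (2 * k + 4))
    simp only [add_assoc, Nat.reduceAdd] at e1 e2
    generalize (1 - q ^ (2 * k + 3) * x)⁻¹ = a at *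
    generalize (1 - q ^ (2 * k + 5) * x)⁻¹ = b at *
    generalize (x - q ^ (2 * k + 1))⁻¹ = c at *
    generalize wpCommon q x k = v at *
    linear_combination (1 - q ^ (2 * k + 2) * x) * (x - q ^ (2 * k)) * a * c * q ^ 2 * ih +
      v * (q ^ 2 * x - q ^ (2 * k)) * q ^ 2 * (1 - q ^ (2 * k + 2) * x) * (x - q ^ (2 * k)) * c *
        (e1 - e2)

theorem wpRatio_sq_mul_eq (hx : ∀ i, 1 - q ^ (i + 1) * x ≠ 0)
    (hx' : ∀ i, q * x - q ^ (2 * i) ≠ 0) (hq : q ≠ 0) (k : ℕ) :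
    wpRatio q (q ^ 2 * x) k * (q ^ (2 * k) * (1 - q ^ 2 * x) * (q * x - 1)) =
      wpCommon q x k * ((1 - q ^ (2 * k + 2) * x) * (q * x - q ^ (2 * k))) := by
  induction k with
  | zero => simp [wpRatio, wpCommon]
  | succ k ih =>
    rw [wpRatio, wpCommon, prod_range_succ, prod_range_succ, ← wpRatio, ← wpCommon,
      div_eq_mul_inv, div_eq_mul_inv, mul_inv, mul_inv]
    have e2 := mul_inv_cancel₀ (hx (2 * k + 4))
    have e3 := mul_inv_cancel₀ (hx' k)
    have e4 := mul_inv_cancel₀ (hx' (k + 1))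
    have e5 := mul_inv_cancel₀ hq
    have r1 : q ^ 2 * x - q ^ (2 * k + 1) = q * (q * x - q ^ (2 * k)) := by ring
    have r2 : x - q ^ (2 * k + 1) = q⁻¹ * (q * x - q ^ (2 * (k + 1))) := by
      linear_combination (-x + q ^ (2 * k + 1)) * e5
    have r3 : 1 - q ^ (2 * k + 3) * (q ^ 2 * x) = 1 - q ^ (2 * k + 5) * x := by ring
    simp only [add_assoc, Nat.reduceAdd] at e2
    rw [r1, r2, r3, mul_inv, mul_inv, inv_inv]
    generalize (1 - q ^ (2 * k + 5) * x)⁻¹ = b at *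
    generalize (q * x - q ^ (2 * k))⁻¹ = c at *
    generalize (q * x - q ^ (2 * (k + 1)))⁻¹ = d at *
    generalize q⁻¹ = e at *
    generalize wpCommon q x k = v at *
    linear_combination
      (1 - q ^ (2 * k + 4) * x) * (q ^ 2 * x - q ^ (2 * k)) * b * (e * c) * q ^ 2 * ih +
      v * (1 - q ^ (2 * k + 2) * x) * (q ^ 2 * x - q ^ (2 * k)) * (1 - q ^ (2 * k + 4) * x) * b *
        (q ^ 2 * e * e3 + q * e5 - q * e4)

/-- Contiguous relation: a combination of the ratios at x and q²x is a multiple of `wpCommon`, whose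
weighted sum telescopes. -/
theorem wpRatio_sub (hx : ∀ i, 1 - q ^ (i + 1) * x ≠ 0)
    (hx' : ∀ i, q * x - q ^ (2 * i) ≠ 0) (hq : q ≠ 0) (k : ℕ) :
    (q * (1 - q * x) * wpRatio q (q ^ 2 * x) k - (1 - q ^ 3 * x) * wpRatio q x k) *
        (1 - q ^ 2 * x) =
      -((1 - q) * (1 - q ^ 4 * x ^ 2)) * wpCommon q x k := by
  have e1 := wpRatio_mul_eq hx k
  have e2 := wpRatio_sq_mul_eq hx hx' hq k
  refine mul_left_cancel₀ (pow_ne_zero (2 * k) hq) ?_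
  linear_combination -q * e2 + e1

/-- Closed form for the partial sums, in the manner of Gosper summation; denominators are cleared so
that induction on the upper limit is a polynomial identity. -/
theorem sum_wpCommon (hx : ∀ i, 1 - q ^ (i + 1) * x ≠ 0)
    (hx' : ∀ i, q * x - q ^ (2 * i) ≠ 0) (hq1 : ∀ i, 1 - q ^ (i + 1) ≠ 0) (K : ℕ) :
    q ^ (2 * K) * ((1 - q) * (1 - q ^ 2 * x) ^ 2 *
        ∑ k ∈ range K, (1 - q ^ (4 * k + 1)) * qCentral q k ^ 2 * wpCommon q x k) =
      -q * qCentral q K ^ 2 * wpCommon q x K * (1 - q ^ (2 * K)) ^ 2 *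
        (1 - q ^ (2 * K + 3) * x) * (q * x - q ^ (2 * K)) := by
  induction K with
  | zero => simp
  | succ k ih =>
    rw [sum_range_succ]
    have hv : qCentral q (k + 1) * (1 - q ^ (2 * (k + 1))) =
        qCentral q k * (1 - q ^ (2 * k + 1)) := by
      rw [qCentral, prod_range_succ, ← qCentral, mul_assoc]
      congr 1
      exact div_mul_cancel₀ _ (hq1 (2 * k + 1))
    have hH : wpCommon q x (k + 1) * ((1 - q ^ (2 * (k + 1) + 3) * x) *
        (q * x - q ^ (2 * (k + 1)))) =
        wpCommon q x k * (q * ((1 - q ^ (2 * k + 2) * x) * (q ^ 2 * x - q ^ (2 * k)))) := by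
      rw [wpCommon, prod_range_succ, ← wpCommon, mul_assoc]
      congr 1
      have h1 := hx (2 * k + 4)
      have h2 : x - q ^ (2 * k + 1) ≠ 0 := fun h => hx' (k + 1) (by linear_combination q * h)
      simp only [add_assoc, Nat.reduceAdd] at h1
      rw [show q * x - q ^ (2 * (k + 1)) = q * (x - q ^ (2 * k + 1)) by ring,
        show 2 * (k + 1) + 3 = 2 * k + 5 by ring]
      rw [div_mul_eq_mul_div, div_eq_iff (mul_ne_zero h1 h2)]
      ring
    calc _ = q ^ 2 * (q ^ (2 * k) * ((1 - q) * (1 - q ^ 2 * x) ^ 2 *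
        ∑ k ∈ range k, (1 - q ^ (4 * k + 1)) * qCentral q k ^ 2 * wpCommon q x k)) +
        q ^ 2 * (q ^ (2 * k) * ((1 - q) * (1 - q ^ 2 * x) ^ 2 *
          ((1 - q ^ (4 * k + 1)) * qCentral q k ^ 2 * wpCommon q x k))) := by ring
      _ = -q * (qCentral q k * (1 - q ^ (2 * k + 1))) ^ 2 *
        (wpCommon q x k * (q * ((1 - q ^ (2 * k + 2) * x) * (q ^ 2 * x - q ^ (2 * k))))) := by
        rw [ih]; ring
      _ = _ := by rw [← hv, ← hH]; ring

/-- Terminating 6φ5 sum in base q² at argument 1, with x = q^(2m). Induction on m moves x to q²x by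
the contiguous relation. -/
theorem sum_wpRatio (hq : q ≠ 0) (hq1 : ∀ i, 1 - q ^ (i + 1) ≠ 0) (m : ℕ) :
    q ^ m * ∑ k ∈ range (m + 1),
        (1 - q ^ (4 * k + 1)) * qCentral q k ^ 2 * wpRatio q (q ^ (2 * m)) k =
      1 - q ^ (2 * m + 1) := by
  induction m with
  | zero => simp [qCentral, wpRatio]
  | succ m ih =>
    have hx : ∀ i, 1 - q ^ (i + 1) * q ^ (2 * m) ≠ 0 := fun i => by
      rw [← pow_add, add_right_comm]; exact hq1 _
    have hx' : ∀ i, q * q ^ (2 * m) - q ^ (2 * i) ≠ 0 := fun i h => by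
      rcases le_or_gt i m with him | him
      · obtain ⟨j, rfl⟩ := Nat.exists_eq_add_of_le him
        refine mul_ne_zero (pow_ne_zero (2 * i) hq) (hq1 (2 * j)) ?_
        linear_combination -h
      · obtain ⟨j, rfl⟩ := Nat.exists_eq_add_of_lt him
        refine mul_ne_zero (pow_ne_zero (2 * m + 1) hq) (hq1 (2 * j)) ?_
        linear_combination h
    -- The limit m + 2 takes in the zero factor i = m + 1, so the telescoped closed form vanishes.
    have hH : wpCommon q (q ^ (2 * m)) (m + 2) = 0 :=
      prod_eq_zero (mem_range.2 (show m + 1 < m + 2 by omega)) (by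
        rw [show q ^ 2 * q ^ (2 * m) - q ^ (2 * (m + 1)) = 0 by ring]; simp)
    have hp : wpRatio q (q ^ (2 * m)) (m + 1) = 0 :=
      prod_eq_zero (mem_range.2 (Nat.lt_succ_self m)) (by simp)
    have hs := sum_wpCommon hx hx' hq1 (m + 2)
    have h2 : 1 - q ^ 2 * q ^ (2 * m) ≠ 0 := hx 1
    have hz : ∑ k ∈ range (m + 2), (1 - q ^ (4 * k + 1)) * qCentral q k ^ 2 *
        wpCommon q (q ^ (2 * m)) k = 0 := by
      rw [hH] at hs
      have h1 := hq1 0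
      simp only [zero_add, pow_one] at h1
      simpa [hq, h1, h2] using hs
    have hd : q * (1 - q * q ^ (2 * m)) * (∑ k ∈ range (m + 2),
          (1 - q ^ (4 * k + 1)) * qCentral q k ^ 2 * wpRatio q (q ^ 2 * q ^ (2 * m)) k) -
        (1 - q ^ 3 * q ^ (2 * m)) * (∑ k ∈ range (m + 2),
          (1 - q ^ (4 * k + 1)) * qCentral q k ^ 2 * wpRatio q (q ^ (2 * m)) k) = 0 := by
      refine (mul_eq_zero.1 ?_).resolve_right h2
      rw [mul_sum, mul_sum, ← sum_sub_distrib, sum_mul,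
        ← mul_zero (-((1 - q) * (1 - q ^ 4 * (q ^ (2 * m)) ^ 2))), ← hz, mul_sum]
      exact sum_congr rfl fun k _ => by
        linear_combination (1 - q ^ (4 * k + 1)) * qCentral q k ^ 2 * wpRatio_sub hx hx' hq k
    rw [sum_range_succ (fun k => (1 - q ^ (4 * k + 1)) * qCentral q k ^ 2 *
      wpRatio q (q ^ (2 * m)) k), hp, mul_zero, add_zero,
      show q ^ 2 * q ^ (2 * m) = q ^ (2 * (m + 1)) by ring] at hd
    refine mul_left_cancel₀ (hx 0) ?_
    rw [show m + 1 + 1 = m + 2 by rfl]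
    linear_combination q ^ m * hd + (1 - q ^ 3 * q ^ (2 * m)) * ih

end Field

/-! ### Passing between ratios and cleared sums. -/

/-- The product of the `m` even-exponent factors. -/
def evenProd {R : Type*} [CommRing R] (q a w : R) (m : ℕ) : R :=
  ∏ i ∈ range m, quadFactor a w (q ^ (2 * i + 2))

theorem map_evenProd {R S : Type*} [CommRing R] [CommRing S] (f : R →+* S) (q a w : R) (m : ℕ) :
    f (evenProd q a w m) = evenProd (f q) (f a) (f w) m := by
  simp [evenProd, quadFactor]

theorem quadFactor_one_zero {R : Type*} [CommRing R] (u : R) :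
    quadFactor 1 0 u = (1 - u) ^ 2 := by
  simp [quadFactor]

theorem quadFactor_one_sub_sq {R : Type*} [CommRing R] (a u : R) :
    quadFactor a ((1 - a) ^ 2) u = (1 - a * u) * (a - u) := by
  unfold quadFactor
  ring

section Field

variable {K : Type*} [Field K] {q : K}

theorem mixedProd_eq_evenProd_mul (a w : K) (m k : ℕ) (hk : k ≤ m)
    (h : ∀ i < m, quadFactor a w (q ^ (2 * i + 2)) ≠ 0) :
    mixedProd q a w m k = evenProd q a w m *
      ∏ i ∈ range k, quadFactor a w (q ^ (2 * i + 1)) / quadFactor a w (q ^ (2 * i + 2)) := by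
  rw [mixedProd, evenProd, ← prod_range_mul_prod_Ico _ hk, prod_div_distrib]
  have h1 : ∏ i ∈ range k, quadFactor a w (q ^ (2 * i + 2)) ≠ 0 := prod_ne_zero_iff.2 fun i hi =>
    h i ((mem_range.1 hi).trans_le hk)
  field_simp

theorem mixedProd_one_zero {m : ℕ} (hq1 : ∀ i < m, 1 - q ^ (2 * i + 2) ≠ 0) (k : ℕ) (hk : k ≤ m) :
    mixedProd q 1 0 m k = evenProd q 1 0 m * qCentral q k ^ 2 := by
  rw [mixedProd_eq_evenProd_mul _ _ _ _ hk, qCentral, ← prod_pow]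
  · simp_rw [quadFactor_one_zero, div_pow]
  · intro i hi
    rw [quadFactor_one_zero]
    exact pow_ne_zero _ (hq1 i hi)

theorem clearedSum_one_zero {m : ℕ} (hq1 : ∀ i < m, 1 - q ^ (2 * i + 2) ≠ 0) :
    clearedSum q 1 0 m = evenProd q 1 0 m ^ 2 *
      ∑ k ∈ range (m + 1), qInteger q (4 * k + 1) * qCentral q k ^ 4 := by
  rw [clearedSum, mul_sum]
  refine sum_congr rfl fun k hk => ?_
  rw [mixedProd_one_zero hq1 k (Nat.lt_succ_iff.1 (mem_range.1 hk))]
  ring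

/-- At a = q^(2m+1) and w = (1 - a)² the deformed factors split linearly, and their ratios are those
of `wpRatio` at x = q^(2m). -/
theorem pow_mul_clearedSum (hq : q ≠ 0) (hq1 : ∀ i, 1 - q ^ (i + 1) ≠ 0) (m : ℕ) :
    q ^ m * clearedSum q (q ^ (2 * m + 1)) ((1 - q ^ (2 * m + 1)) ^ 2) m =
      evenProd q 1 0 m * evenProd q (q ^ (2 * m + 1)) ((1 - q ^ (2 * m + 1)) ^ 2) m *
        qInteger q (2 * m + 1) := by
  have h0 := hq1 0
  rw [zero_add, pow_one] at h0
  refine mul_left_cancel₀ h0 ?_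
  have hx : ∀ i, quadFactor (q ^ (2 * m + 1)) ((1 - q ^ (2 * m + 1)) ^ 2) (q ^ (2 * i + 2)) ≠ 0 := by
    intro i
    rw [quadFactor_one_sub_sq]
    refine mul_ne_zero ?_ fun h => ?_
    · rw [← pow_add]; exact hq1 (2 * m + 1 + (2 * i + 1))
    · rcases le_or_gt (i + 1) m with him | him
      · obtain ⟨j, rfl⟩ := Nat.exists_eq_add_of_le him
        refine mul_ne_zero (pow_ne_zero (2 * i + 2) hq) (hq1 (2 * j)) ?_
        linear_combination -h
      · obtain ⟨j, rfl⟩ := Nat.exists_eq_add_of_le (Nat.lt_succ_iff.1 him)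
        refine mul_ne_zero (pow_ne_zero (2 * m + 1) hq) (hq1 (2 * j)) ?_
        linear_combination h
  have hp : ∀ k, (∏ i ∈ range k,
      quadFactor (q ^ (2 * m + 1)) ((1 - q ^ (2 * m + 1)) ^ 2) (q ^ (2 * i + 1)) /
      quadFactor (q ^ (2 * m + 1)) ((1 - q ^ (2 * m + 1)) ^ 2) (q ^ (2 * i + 2))) =
      wpRatio q (q ^ (2 * m)) k := fun k => prod_congr rfl fun i _ => by
    rw [quadFactor_one_sub_sq, quadFactor_one_sub_sq,
      show (1 - q ^ (2 * m + 1) * q ^ (2 * i + 1)) * (q ^ (2 * m + 1) - q ^ (2 * i + 1)) =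
        q * ((1 - q ^ (2 * i + 2) * q ^ (2 * m)) * (q ^ (2 * m) - q ^ (2 * i))) by ring,
      show (1 - q ^ (2 * m + 1) * q ^ (2 * i + 2)) * (q ^ (2 * m + 1) - q ^ (2 * i + 2)) =
        q * ((1 - q ^ (2 * i + 3) * q ^ (2 * m)) * (q ^ (2 * m) - q ^ (2 * i + 1))) by ring,
      mul_div_mul_left _ _ hq]
  calc _ = evenProd q 1 0 m * evenProd q (q ^ (2 * m + 1)) ((1 - q ^ (2 * m + 1)) ^ 2) m *
      (q ^ m * ∑ k ∈ range (m + 1),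
        (1 - q ^ (4 * k + 1)) * qCentral q k ^ 2 * wpRatio q (q ^ (2 * m)) k) := by
        rw [clearedSum, mul_sum, mul_sum, mul_sum, mul_sum]
        refine sum_congr rfl fun k hk => ?_
        have hk' : k ≤ m := Nat.lt_succ_iff.1 (mem_range.1 hk)
        rw [mixedProd_one_zero (fun i _ => hq1 (2 * i + 1)) k hk',
          mixedProd_eq_evenProd_mul _ _ _ _ hk' fun i _ => hx i, hp]
        linear_combination (q ^ m * evenProd q 1 0 m * qCentral q k ^ 2 *
          evenProd q (q ^ (2 * m + 1)) ((1 - q ^ (2 * m + 1)) ^ 2) m *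
          wpRatio q (q ^ (2 * m)) k) * one_sub_mul_qInteger q (4 * k + 1)
    _ = _ := by
      rw [sum_wpRatio hq hq1]
      linear_combination -(evenProd q 1 0 m *
        evenProd q (q ^ (2 * m + 1)) ((1 - q ^ (2 * m + 1)) ^ 2) m) *
        one_sub_mul_qInteger q (2 * m + 1)

end Field

/-! ### The congruence modulo Φ³ in ℚ[X]. -/

open Polynomial in
theorem ratFunc_one_sub_X_pow_ne_zero (i : ℕ) : (1 : RatFunc ℚ) - RatFunc.X ^ (i + 1) ≠ 0 := by
  have h : (X ^ (i + 1) - C 1 : ℚ[X]) ≠ 0 := X_pow_sub_C_ne_zero i.succ_pos 1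
  rw [← neg_sub, neg_ne_zero]
  simpa using (map_ne_zero_iff _ (RatFunc.algebraMap_injective ℚ)).2 h

open Polynomial

theorem X_pow_mul_clearedSum (m : ℕ) :
    (X : ℚ[X]) ^ m * clearedSum X (X ^ (2 * m + 1)) ((1 - X ^ (2 * m + 1)) ^ 2) m =
      evenProd X 1 0 m * evenProd X (X ^ (2 * m + 1)) ((1 - X ^ (2 * m + 1)) ^ 2) m *
        qInteger X (2 * m + 1) := by
  refine RatFunc.algebraMap_injective ℚ ?_
  have h := pow_mul_clearedSum RatFunc.X_ne_zero ratFunc_one_sub_X_pow_ne_zero m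
  simpa [map_clearedSum, map_evenProd, qInteger] using h

theorem clearedSum_zero_right {R : Type*} [CommRing R] (q a : R) (m : ℕ) :
    clearedSum q a 0 m = a ^ m * clearedSum q 1 0 m := by
  have h : ∀ k ≤ m, mixedProd q a 0 m k = a ^ m * mixedProd q 1 0 m k := fun k hk => by
    have h1 : ∀ u : R, quadFactor a 0 u = a * quadFactor 1 0 u := fun u => by
      unfold quadFactor; ring
    simp_rw [mixedProd, h1, prod_mul_distrib]
    rw [prod_const, prod_const, card_range, Nat.card_Ico]
    nth_rewrite 3 [← Nat.add_sub_cancel' hk]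
    rw [pow_add]
    ring
  rw [clearedSum, clearedSum, mul_sum]
  refine sum_congr rfl fun k hk => ?_
  rw [h k (Nat.lt_succ_iff.1 (mem_range.1 hk))]
  ring

theorem evenProd_zero_right {R : Type*} [CommRing R] (q a : R) (m : ℕ) :
    evenProd q a 0 m = a ^ m * evenProd q 1 0 m := by
  have h1 : ∀ u : R, quadFactor a 0 u = a * quadFactor 1 0 u := fun u => by
    unfold quadFactor; ring
  simp_rw [evenProd, h1, prod_mul_distrib]
  rw [prod_const, card_range]

theorem dvd_evenProd_sub {R : Type*} [CommRing R] (q a w : R) (m : ℕ) :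
    w ∣ evenProd q a w m - evenProd q a 0 m := by
  rw [← Ideal.mem_span_singleton, ← Ideal.Quotient.eq, map_evenProd, map_evenProd, map_zero,
    Ideal.Quotient.eq_zero_iff_mem.2 (Ideal.mem_span_singleton_self w)]

theorem cyclotomic_dvd_iff_aeval {n : ℕ} {z : ℂ} (hz : IsPrimitiveRoot z n) (hn : 0 < n)
    (f : ℚ[X]) : cyclotomic n ℚ ∣ f ↔ aeval z f = 0 := by
  rw [cyclotomic_eq_minpoly_rat hz hn, minpoly.dvd_iff]

theorem map_clearedSum_eq_zero (φ : ℚ[X] →+* ℂ) (m : ℕ) (h1 : φ X ^ (2 * m + 1) = 1)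
    (h2 : φ X ≠ 1) :
    (clearedSum (C X) (C (X ^ (2 * m + 1))) X m : ℚ[X][X]).map φ = 0 := by
  rw [← coe_mapRingHom, map_clearedSum, coe_mapRingHom, map_C, map_C, map_X, map_pow, h1, C_1]
  refine clearedSum_eq_zero _ _ _ ?_ ?_
  · rw [← C_pow, h1, C_1]
  · rw [← C_1, Ne, C_inj]
    exact h2

/-- With w as an outer indeterminate, all coefficients vanish at a primitive root, so Φ divides the
polynomial in w. The difference of its values at w and 0 supplies the further factor w. -/
theorem cyclotomic_mul_dvd_clearedSum_sub (m : ℕ) (hm : 0 < m) :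
    cyclotomic (2 * m + 1) ℚ * (1 - X ^ (2 * m + 1)) ^ 2 ∣
      clearedSum X (X ^ (2 * m + 1)) ((1 - X ^ (2 * m + 1)) ^ 2) m -
        clearedSum X (X ^ (2 * m + 1)) 0 m := by
  set Φ := cyclotomic (2 * m + 1) ℚ with hΦ
  set w : ℚ[X] := (1 - X ^ (2 * m + 1)) ^ 2
  let P : ℚ[X][X] := clearedSum (C X) (C (X ^ (2 * m + 1))) X m
  have hev : ∀ v : ℚ[X], clearedSum X (X ^ (2 * m + 1)) v m = P.eval v := fun v => by
    rw [← coe_evalRingHom, map_clearedSum]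
    simp
  have hz := Complex.isPrimitiveRoot_exp (2 * m + 1) (by omega)
  generalize Complex.exp (2 * Real.pi * Complex.I / ((2 * m + 1 : ℕ) : ℂ)) = z at hz
  let φ : ℚ[X] →+* ℂ := (aeval z : ℚ[X] →ₐ[ℚ] ℂ)
  have hφ : φ X = z := aeval_X z
  have hφ1 : φ X ^ (2 * m + 1) = 1 := by rw [hφ, hz.pow_eq_one]
  have hφ2 : φ X ≠ 1 := by rw [hφ]; exact hz.ne_one (by omega)
  have hP : P.map φ = 0 := map_clearedSum_eq_zero φ m hφ1 hφ2
  have hC : C Φ ∣ P := by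
    rw [C_dvd_iff_dvd_coeff]
    intro i
    rw [hΦ, cyclotomic_dvd_iff_aeval hz (by omega)]
    exact (coeff_map φ i).symm.trans (by rw [hP, coeff_zero])
  obtain ⟨P', hP'⟩ := hC
  rw [hev, hev, hP', eval_mul, eval_mul, eval_C, eval_C, ← mul_sub]
  refine mul_dvd_mul_left _ ?_
  simpa using sub_dvd_eval_sub w 0 P'

theorem cyclotomic_dvd_qInteger {n : ℕ} (hn : 1 < n) : cyclotomic n ℚ ∣ qInteger X n := by
  rw [qInteger, ← prod_cyclotomic_eq_geom_sum (by omega)]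
  exact dvd_prod_of_mem _ (by simp; omega)

theorem cyclotomic_dvd_one_sub_X_pow (n : ℕ) : cyclotomic n ℚ ∣ 1 - X ^ n := by
  rw [← neg_sub, dvd_neg]
  exact cyclotomic.dvd_X_pow_sub_one n ℚ

theorem isCoprime_cyclotomic_X {n : ℕ} (hn : 0 < n) : IsCoprime (cyclotomic n ℚ) X := by
  obtain ⟨t, ht⟩ := cyclotomic_dvd_one_sub_X_pow n
  refine IsCoprime.of_mul_right_left (z := X ^ (n - 1)) ⟨t, 1, ?_⟩
  rw [← pow_succ', Nat.sub_add_cancel hn]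
  linear_combination -ht

theorem cyclotomic_cube_dvd (m : ℕ) (hm : 0 < m) :
    cyclotomic (2 * m + 1) ℚ ^ 3 ∣
      X ^ m * clearedSum X 1 0 m - evenProd X 1 0 m ^ 2 * qInteger X (2 * m + 1) := by
  set Φ := cyclotomic (2 * m + 1) ℚ with hΦ
  -- At w = 0 the parameter a = X^(2m+1) factors out as a^m; this power is harmless modulo Φ.
  have hcop : IsCoprime (Φ ^ 3) ((X ^ (2 * m + 1)) ^ m) :=
    (((isCoprime_cyclotomic_X (by omega)).pow_right).pow_right).pow_left
  refine hcop.dvd_of_dvd_mul_left ?_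
  have hw : Φ ^ 2 ∣ (1 - X ^ (2 * m + 1)) ^ 2 := pow_dvd_pow_of_dvd (cyclotomic_dvd_one_sub_X_pow _) 2
  have h1 : Φ ^ 3 ∣ clearedSum X (X ^ (2 * m + 1)) ((1 - X ^ (2 * m + 1)) ^ 2) m -
      clearedSum X (X ^ (2 * m + 1)) 0 m := by
    rw [pow_succ']
    exact (mul_dvd_mul_left _ hw).trans (cyclotomic_mul_dvd_clearedSum_sub m hm)
  have h2 : Φ ^ 3 ∣ (evenProd X (X ^ (2 * m + 1)) ((1 - X ^ (2 * m + 1)) ^ 2) m -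
      evenProd X (X ^ (2 * m + 1)) 0 m) * qInteger X (2 * m + 1) := by
    rw [pow_succ]
    exact mul_dvd_mul (hw.trans (dvd_evenProd_sub _ _ _ _)) (cyclotomic_dvd_qInteger (by omega))
  rw [clearedSum_zero_right] at h1
  rw [evenProd_zero_right] at h2
  have e := X_pow_mul_clearedSum m
  have h3 := (h2.mul_left (evenProd X 1 0 m)).sub (h1.mul_left (X ^ m))
  convert h3 using 1
  linear_combination e

/-! ### The local ring at a root of unity. -/

/-- Rational functions whose reduced denominator does not vanish at `z`. -/
noncomputable def regularAt (z : ℂ) : Subring (RatFunc ℚ) where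
  carrier := {f | aeval z f.denom ≠ 0}
  mul_mem' {f g} hf hg h := by
    refine mul_ne_zero hf hg ?_
    rw [← map_mul]
    exact aeval_eq_zero_of_dvd_aeval_eq_zero (RatFunc.denom_mul_dvd f g) h
  one_mem' := by simp
  add_mem' {f g} hf hg h := by
    refine mul_ne_zero hf hg ?_
    rw [← map_mul]
    exact aeval_eq_zero_of_dvd_aeval_eq_zero (RatFunc.denom_add_dvd f g) h
  zero_mem' := by simp
  neg_mem' {f} hf h := by
    refine hf (aeval_eq_zero_of_dvd_aeval_eq_zero ?_ h)
    refine (RatFunc.denom_dvd (RatFunc.denom_ne_zero f)).2 ⟨-f.num, ?_⟩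
    rw [map_neg, neg_div, RatFunc.num_div_denom]

/-- Evaluation at `z`. -/
noncomputable def evalAt (z : ℂ) : regularAt z →+* ℂ where
  toFun f := RatFunc.eval (algebraMap ℚ ℂ) z f
  map_one' := by simp
  map_zero' := by simp
  map_add' f g := RatFunc.eval_add (f := algebraMap ℚ ℂ) (a := z) f.2 g.2
  map_mul' f g := RatFunc.eval_mul (f := algebraMap ℚ ℂ) (a := z) f.2 g.2

theorem algebraMap_mem_regularAt (z : ℂ) (p : ℚ[X]) : algebraMap ℚ[X] (RatFunc ℚ) p ∈ regularAt z := by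
  change aeval z _ ≠ 0
  simp

theorem div_mem_regularAt {z : ℂ} (p : ℚ[X]) {r : ℚ[X]} (hr : aeval z r ≠ 0) :
    algebraMap ℚ[X] (RatFunc ℚ) p / algebraMap ℚ[X] (RatFunc ℚ) r ∈ regularAt z := fun h =>
  hr (aeval_eq_zero_of_dvd_aeval_eq_zero (RatFunc.denom_div_dvd p r) h)

/-- Polynomials as elements of `regularAt z`. -/
noncomputable def polyAt (z : ℂ) : ℚ[X] →+* regularAt z :=
  (algebraMap ℚ[X] (RatFunc ℚ)).codRestrict _ (algebraMap_mem_regularAt z)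

theorem evalAt_polyAt (z : ℂ) (p : ℚ[X]) : evalAt z (polyAt z p) = aeval z p := by
  change RatFunc.eval (algebraMap ℚ ℂ) z (algebraMap ℚ[X] (RatFunc ℚ) p) = _
  rw [RatFunc.eval_algebraMap]
  rfl

theorem algebraMap_ne_zero_of_aeval_ne_zero {z : ℂ} {p : ℚ[X]} (hp : aeval z p ≠ 0) :
    algebraMap ℚ[X] (RatFunc ℚ) p ≠ 0 :=
  (map_ne_zero_iff _ (RatFunc.algebraMap_injective ℚ)).2 fun h => hp (by rw [h, map_zero])

theorem isUnit_polyAt {z : ℂ} {p : ℚ[X]} (hp : aeval z p ≠ 0) : IsUnit (polyAt z p) := by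
  have h : algebraMap ℚ[X] (RatFunc ℚ) p *
      (algebraMap ℚ[X] (RatFunc ℚ) 1 / algebraMap ℚ[X] (RatFunc ℚ) p) = 1 := by
    rw [map_one, mul_one_div_cancel (algebraMap_ne_zero_of_aeval_ne_zero hp)]
  exact IsUnit.of_mul_eq_one ⟨_, div_mem_regularAt 1 hp⟩ (Subtype.ext h)

theorem cyclotomic_dvd_num {n : ℕ} {z : ℂ} (hz : IsPrimitiveRoot z n) (hn : 0 < n)
    {f : regularAt z} (hf : evalAt z f = 0) : cyclotomic n ℚ ∣ (f : RatFunc ℚ).num := by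
  rw [cyclotomic_dvd_iff_aeval hz hn]
  have h : aeval z (f : RatFunc ℚ).num / aeval z (f : RatFunc ℚ).denom = 0 := hf
  exact (div_eq_zero_iff.1 h).resolve_right f.2

/-- The cofactor is regular at z, so the irreducible Φ_n is coprime to its denominator and no power
of Φ_n is lost in lowest terms. -/
theorem cyclotomic_pow_dvd_num {n r : ℕ} {z : ℂ} (hz : IsPrimitiveRoot z n) (hn : 0 < n)
    {f : regularAt z} (hf : polyAt z (cyclotomic n ℚ) ^ r ∣ f) :
    cyclotomic n ℚ ^ r ∣ (f : RatFunc ℚ).num := by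
  obtain ⟨h, rfl⟩ := hf
  have hirr : Irreducible (cyclotomic n ℚ) := cyclotomic.irreducible_rat hn
  have hc : IsCoprime (cyclotomic n ℚ ^ r) (h : RatFunc ℚ).denom := by
    refine IsCoprime.pow_left (hirr.coprime_iff_not_dvd.2 ?_)
    rw [cyclotomic_dvd_iff_aeval hz hn]
    exact h.2
  refine hc.dvd_of_dvd_mul_right (y := _) ?_
  have e : ((polyAt z (cyclotomic n ℚ) ^ r * h : regularAt z) : RatFunc ℚ) =
      algebraMap ℚ[X] (RatFunc ℚ) (cyclotomic n ℚ ^ r * (h : RatFunc ℚ).num) /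
        algebraMap ℚ[X] (RatFunc ℚ) (h : RatFunc ℚ).denom := by
    rw [map_mul, mul_div_assoc, RatFunc.num_div_denom, map_pow]
    rfl
  have e' := (RatFunc.num_mul_eq_mul_denom_iff (RatFunc.denom_ne_zero (h : RatFunc ℚ))).2 e
  rw [e', mul_assoc]
  exact dvd_mul_right _ _

theorem coe_polyAt (z : ℂ) (p : ℚ[X]) :
    (polyAt z p : RatFunc ℚ) = algebraMap ℚ[X] (RatFunc ℚ) p := rfl

theorem polyAt_mul_eq_iff {z : ℂ} {p r : ℚ[X]} {f : regularAt z} :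
    f * polyAt z p = polyAt z r ↔
      (f : RatFunc ℚ) * algebraMap ℚ[X] (RatFunc ℚ) p = algebraMap ℚ[X] (RatFunc ℚ) r :=
  Subtype.ext_iff

/-! ### Regularity and block structure of `qCentral`. -/

theorem prod_div_mul_algebraMap_prod (k b : ℕ) :
    (∏ i ∈ range b, (1 - RatFunc.X ^ (2 * (k + i) + 1)) / (1 - RatFunc.X ^ (2 * (k + i) + 2))) *
      algebraMap ℚ[X] (RatFunc ℚ) (∏ i ∈ range b, (1 - X ^ (2 * (k + i) + 2))) =
      algebraMap ℚ[X] (RatFunc ℚ) (∏ i ∈ range b, (1 - X ^ (2 * (k + i) + 1))) := by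
  rw [map_prod, map_prod, ← prod_mul_distrib]
  refine prod_congr rfl fun i _ => ?_
  have := ratFunc_one_sub_X_pow_ne_zero (2 * (k + i) + 1)
  simp [div_mul_cancel₀ _ this]

section RootOfUnity

variable {m : ℕ} {z : ℂ} (hz : IsPrimitiveRoot z (2 * m + 1))

theorem pow_mul_add_two_ne_one (hz : IsPrimitiveRoot z (2 * m + 1)) (a : ℕ) {i : ℕ} (hi : i < 2 * m) :
    1 - z ^ (2 * (a * (2 * m + 1) + i) + 2) ≠ 0 := by
  rw [sub_ne_zero, ne_comm, Ne, hz.pow_eq_one_iff_dvd,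
    show 2 * (a * (2 * m + 1) + i) + 2 = 2 * (i + 1) + (2 * m + 1) * (2 * a) by ring,
    Nat.dvd_add_left (dvd_mul_right _ _)]
  intro h
  have h1 : 2 * m + 1 ∣ i + 1 :=
    (Nat.Coprime.dvd_mul_left (by simp)).1 h
  have := Nat.le_of_dvd (by omega) h1
  omega

theorem pow_mul_add (hz : IsPrimitiveRoot z (2 * m + 1)) (a j : ℕ) : z ^ (2 * (a * (2 * m + 1)) + j) = z ^ j := by
  rw [show 2 * (a * (2 * m + 1)) + j = (2 * m + 1) * (2 * a) + j by ring, pow_add, pow_mul,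
    hz.pow_eq_one, one_pow, one_mul]

theorem exists_regularAt_prod_of_le (hz : IsPrimitiveRoot z (2 * m + 1)) (a : ℕ) {b : ℕ} (hb : b ≤ 2 * m) :
    ∃ B : regularAt z, (B : RatFunc ℚ) = ∏ i ∈ range b,
      (1 - RatFunc.X ^ (2 * (a * (2 * m + 1) + i) + 1)) /
        (1 - RatFunc.X ^ (2 * (a * (2 * m + 1) + i) + 2)) ∧ evalAt z B = qCentral z b := by
  have hQ : aeval z (∏ i ∈ range b, (1 - X ^ (2 * (a * (2 * m + 1) + i) + 2)) : ℚ[X]) ≠ 0 := by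
    rw [map_prod, prod_ne_zero_iff]
    intro i hi
    simpa using pow_mul_add_two_ne_one hz a ((mem_range.1 hi).trans_le hb)
  have hQ0 := algebraMap_ne_zero_of_aeval_ne_zero hQ
  have h := prod_div_mul_algebraMap_prod (a * (2 * m + 1)) b
  have hB := (eq_div_iff hQ0).2 h
  have hmem := div_mem_regularAt (∏ i ∈ range b, (1 - X ^ (2 * (a * (2 * m + 1) + i) + 1))) hQ
  rw [← hB] at hmem
  refine ⟨⟨_, hmem⟩, rfl, ?_⟩
  have h2 := congrArg (evalAt z) ((polyAt_mul_eq_iff (f := ⟨_, hmem⟩)).2 h)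
  rw [map_mul, evalAt_polyAt, evalAt_polyAt] at h2
  rw [(eq_div_iff hQ).2 h2, qCentral, prod_div_distrib, map_prod, map_prod]
  congr 1 <;>
  · refine prod_congr rfl fun i _ => ?_
    rw [map_sub, map_one, map_pow, aeval_X, mul_add 2 (a * (2 * m + 1)) i, add_assoc,
      pow_mul_add hz]

/-- In a full block exactly one numerator factor (i = m) and one denominator factor (i = 2m) vanish
at z; both contain 1 - X^(2m+1), which cancels. -/
theorem regularAt_prod_block (hz : IsPrimitiveRoot z (2 * m + 1)) (a : ℕ) :
    ∏ i ∈ range (2 * m + 1),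
      (1 - RatFunc.X ^ (2 * (a * (2 * m + 1) + i) + 1)) /
        (1 - RatFunc.X ^ (2 * (a * (2 * m + 1) + i) + 2)) ∈ regularAt z := by
  set P : ℚ[X] := qInteger (X ^ (2 * m + 1)) (2 * a + 1) *
    ∏ i ∈ (range (2 * m + 1)).erase m, (1 - X ^ (2 * (a * (2 * m + 1) + i) + 1)) with hP
  set Q : ℚ[X] := qInteger (X ^ (2 * m + 1)) (2 * a + 2) *
    ∏ i ∈ range (2 * m), (1 - X ^ (2 * (a * (2 * m + 1) + i) + 2)) with hQdef
  have hQ : aeval z Q ≠ 0 := by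
    rw [hQdef, map_mul, map_prod]
    refine mul_ne_zero ?_ (prod_ne_zero_iff.2 fun i hi => ?_)
    · have h2 : ((2 * a + 2 : ℕ) : ℂ) ≠ 0 := Nat.cast_ne_zero.2 (by omega)
      simpa [qInteger, hz.pow_eq_one] using h2
    · simpa using pow_mul_add_two_ne_one hz a (mem_range.1 hi)
  have e1 : (∏ i ∈ range (2 * m + 1), (1 - X ^ (2 * (a * (2 * m + 1) + i) + 1)) : ℚ[X]) =
      (1 - X ^ (2 * m + 1)) * P := by
    rw [hP, ← mul_assoc, one_sub_mul_qInteger,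
      ← mul_prod_erase _ _ (mem_range.2 (show m < 2 * m + 1 by omega)), ← pow_mul]
    congr 3
    ring
  have e2 : (∏ i ∈ range (2 * m + 1), (1 - X ^ (2 * (a * (2 * m + 1) + i) + 2)) : ℚ[X]) =
      (1 - X ^ (2 * m + 1)) * Q := by
    rw [hQdef, ← mul_assoc, one_sub_mul_qInteger, prod_range_succ, mul_comm, ← pow_mul]
    congr 3
    ring
  have h := prod_div_mul_algebraMap_prod (a * (2 * m + 1)) (2 * m + 1)
  have hX : algebraMap ℚ[X] (RatFunc ℚ) (1 - X ^ (2 * m + 1)) ≠ 0 := by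
    simpa using ratFunc_one_sub_X_pow_ne_zero (2 * m)
  have hQ0 := algebraMap_ne_zero_of_aeval_ne_zero hQ
  clear_value P Q
  rw [e1, e2, map_mul, map_mul, mul_left_comm] at h
  have hB := (eq_div_iff hQ0).2 (mul_left_cancel₀ hX h)
  rw [hB]
  exact div_mem_regularAt P hQ

theorem regularAt_qCentral_mul (hz : IsPrimitiveRoot z (2 * m + 1)) (a : ℕ) : qCentral RatFunc.X (a * (2 * m + 1)) ∈ regularAt z := by
  induction a with
  | zero => simp [qCentral]
  | succ a ih =>
    rw [Nat.succ_mul, qCentral, prod_range_add]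
    exact (regularAt z).mul_mem ih (regularAt_prod_block hz a)

theorem exists_qCentral_regularAt (hz : IsPrimitiveRoot z (2 * m + 1)) :
    ∃ V : ℕ → regularAt z,
    (∀ k, (V k : RatFunc ℚ) = qCentral RatFunc.X k) ∧
    ∀ a b, b < 2 * m + 1 →
      evalAt z (V (a * (2 * m + 1) + b)) = evalAt z (V (a * (2 * m + 1))) * qCentral z b := by
  have hmem : ∀ k, qCentral RatFunc.X k ∈ regularAt z := fun k => by
    obtain ⟨B, hB, -⟩ := exists_regularAt_prod_of_le hz (k / (2 * m + 1))
      (b := k % (2 * m + 1)) (Nat.lt_succ_iff.1 (Nat.mod_lt _ (by omega)))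
    rw [← Nat.div_add_mod' k (2 * m + 1), qCentral, prod_range_add, ← hB]
    exact (regularAt z).mul_mem (regularAt_qCentral_mul hz _) B.2
  refine ⟨fun k => ⟨_, hmem k⟩, fun k => rfl, fun a b hb => ?_⟩
  obtain ⟨B, hB, hB'⟩ := exists_regularAt_prod_of_le hz a (Nat.lt_succ_iff.1 hb)
  rw [← hB', ← map_mul]
  congr 1
  refine Subtype.ext ?_
  change qCentral RatFunc.X _ = qCentral RatFunc.X _ * (B : RatFunc ℚ)
  rw [hB, qCentral, prod_range_add, ← qCentral]

/-- The numerator contains 1 - q^(2m+1), while the denominator is still a unit at z. -/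
theorem cyclotomic_dvd_of_coe_eq_qCentral (hz : IsPrimitiveRoot z (2 * m + 1))
    {f : regularAt z} {k : ℕ} (hk : m < k) (hk' : k ≤ 2 * m)
    (hf : (f : RatFunc ℚ) = qCentral RatFunc.X k) :
    polyAt z (cyclotomic (2 * m + 1) ℚ) ∣ f := by
  have h := prod_div_mul_algebraMap_prod 0 k
  simp only [zero_add] at h
  rw [← qCentral, ← hf, ← polyAt_mul_eq_iff] at h
  have hu : IsUnit (polyAt z (∏ i ∈ range k, (1 - X ^ (2 * i + 2)))) := by
    refine isUnit_polyAt ?_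
    rw [map_prod, prod_ne_zero_iff]
    intro i hi
    simpa using pow_mul_add_two_ne_one hz 0 ((mem_range.1 hi).trans_le hk')
  rw [← hu.dvd_mul_right, h]
  refine map_dvd _ ((cyclotomic_dvd_one_sub_X_pow _).trans ?_)
  exact dvd_prod_of_mem (fun i => (1 - X ^ (2 * i + 1) : ℚ[X])) (mem_range.2 hk)

end RootOfUnity

/-! ### The terms c_q(k) and their Cauchy square. -/

theorem cTerm_eq (k : ℕ) :
    cTerm k = qInteger RatFunc.X (4 * k + 1) * qCentral RatFunc.X k ^ 4 := by
  have h1 : qShiftedFactorial RatFunc.X (RatFunc.X ^ 2) k =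
      ∏ i ∈ range k, (1 - RatFunc.X ^ (2 * i + 1) : RatFunc ℚ) :=
    prod_congr rfl fun i _ => by ring
  have h2 : qShiftedFactorial (RatFunc.X ^ 2) (RatFunc.X ^ 2) k =
      ∏ i ∈ range k, (1 - RatFunc.X ^ (2 * i + 2) : RatFunc ℚ) :=
    prod_congr rfl fun i _ => by ring
  rw [cTerm, h1, h2, qCentral, prod_div_distrib, div_pow, mul_div_assoc]

theorem map_qInteger {R S : Type*} [CommRing R] [CommRing S] (f : R →+* S) (q : R) (n : ℕ) :
    f (qInteger q n) = qInteger (f q) n := by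
  simp [qInteger]

theorem qInteger_eq_zero_of_pow_eq_one {q : ℂ} {n : ℕ} (hq : q ≠ 1) (h : q ^ n = 1) :
    qInteger q n = 0 := by
  refine (mul_eq_zero.1 ?_).resolve_left (sub_ne_zero.2 hq.symm)
  rw [one_sub_mul_qInteger, h, sub_self]

section RootOfUnity

variable {m : ℕ} {z : ℂ}

theorem exists_cTerm_regularAt (hz : IsPrimitiveRoot z (2 * m + 1)) (hm : 0 < m) :
    ∃ (c : ℕ → regularAt z) (w : ℕ → ℂ), (∀ k, (c k : RatFunc ℚ) = cTerm k) ∧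
      (∀ a b, b < 2 * m + 1 → evalAt z (c (a * (2 * m + 1) + b)) =
        w a * (qInteger z (4 * b + 1) * qCentral z b ^ 4)) ∧
      ∀ k, m < k → k ≤ 2 * m → polyAt z (cyclotomic (2 * m + 1) ℚ) ^ 4 ∣ c k := by
  obtain ⟨V, hV, hV'⟩ := exists_qCentral_regularAt hz
  refine ⟨fun k => polyAt z (qInteger X (4 * k + 1)) * V k ^ 4,
    fun a => evalAt z (V (a * (2 * m + 1))) ^ 4, fun k => ?_, fun a b hb => ?_, fun k hk hk' => ?_⟩
  · rw [cTerm_eq, ← hV]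
    change algebraMap ℚ[X] (RatFunc ℚ) _ * (V k : RatFunc ℚ) ^ 4 = _
    rw [map_qInteger, RatFunc.algebraMap_X]
  · have h1 : 1 - z ≠ 0 := sub_ne_zero.2 (hz.ne_one (by omega)).symm
    have h2 : qInteger z (4 * (a * (2 * m + 1) + b) + 1) = qInteger z (4 * b + 1) := by
      refine mul_left_cancel₀ h1 ?_
      rw [one_sub_mul_qInteger, one_sub_mul_qInteger, ← pow_mul_add hz (2 * a) (4 * b + 1)]
      congr 2
      ring
    have h3 : aeval z (qInteger (X : ℚ[X]) (4 * (a * (2 * m + 1) + b) + 1)) =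
        qInteger z (4 * b + 1) := by
      rw [← h2]
      exact (map_qInteger (aeval z : ℚ[X] →ₐ[ℚ] ℂ).toRingHom X _).trans (by simp)
    rw [map_mul, map_pow, hV' a b hb, evalAt_polyAt, h3]
    ring
  · exact (pow_dvd_pow_of_dvd (cyclotomic_dvd_of_coe_eq_qCentral hz hk hk' (hV k)) 4).mul_left _

theorem qCentral_eq_zero (hz : IsPrimitiveRoot z (2 * m + 1)) {k : ℕ} (hk : m < k) :
    qCentral z k = 0 :=
  prod_eq_zero (mem_range.2 hk) (by rw [hz.pow_eq_one]; simp)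

theorem sum_qCentral_eq_zero (hz : IsPrimitiveRoot z (2 * m + 1)) (hm : 0 < m) :
    ∑ b ∈ range (2 * m + 1), qInteger z (4 * b + 1) * qCentral z b ^ 4 = 0 := by
  have hne : ∀ i < m, 1 - z ^ (2 * i + 2) ≠ 0 := fun i hi => by
    simpa using pow_mul_add_two_ne_one hz 0 (show i < 2 * m by omega)
  have h := clearedSum_eq_zero z 0 m hz.pow_eq_one (hz.ne_one (by omega))
  rw [clearedSum_one_zero hne] at h
  have hD : evenProd z 1 0 m ≠ 0 := prod_ne_zero_iff.2 fun i hi => by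
    rw [quadFactor_one_zero]
    exact pow_ne_zero 2 (hne i (mem_range.1 hi))
  rw [← (mul_eq_zero.1 h).resolve_left (pow_ne_zero 2 hD)]
  refine (sum_subset (range_subset_range.2 (by omega)) fun k _ hk => ?_).symm
  rw [mem_range, not_lt] at hk
  simp [qCentral_eq_zero hz (show m < k by omega)]

theorem evalAt_sum_conv_eq_zero (hz : IsPrimitiveRoot z (2 * m + 1)) (hm : 0 < m)
    {c : ℕ → regularAt z} {w : ℕ → ℂ}
    (hc : ∀ a b, b < 2 * m + 1 → evalAt z (c (a * (2 * m + 1) + b)) =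
      w a * (qInteger z (4 * b + 1) * qCentral z b ^ 4)) (M : ℕ) :
    evalAt z (∑ k ∈ range (M * (2 * m + 1)), ∑ j ∈ range (k + 1), c j * c (k - j)) = 0 := by
  have h := sum_conv_of_block (fun k => evalAt z (c k)) w
    (fun b => qInteger z (4 * b + 1) * qCentral z b ^ 4) m M (fun a _ b hb => hc a b hb)
    (fun b hb _ => by simp [qCentral_eq_zero hz hb])
  rw [sum_qCentral_eq_zero hz hm] at h
  simpa using h

theorem cyclotomic_cube_dvd_sum (hz : IsPrimitiveRoot z (2 * m + 1)) (hm : 0 < m)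
    {c : ℕ → regularAt z} (hc : ∀ k, (c k : RatFunc ℚ) = cTerm k) :
    polyAt z (cyclotomic (2 * m + 1) ℚ) ^ 3 ∣
      polyAt z X ^ m * ∑ k ∈ range (m + 1), c k - polyAt z (qInteger X (2 * m + 1)) := by
  have hD : IsUnit (polyAt z (evenProd X 1 0 m)) := by
    refine isUnit_polyAt ?_
    rw [evenProd, map_prod, prod_ne_zero_iff]
    intro i hi
    rw [quadFactor_one_zero, map_pow]
    have := pow_mul_add_two_ne_one hz 0 (show i < 2 * m by have := mem_range.1 hi; omega)
    exact pow_ne_zero 2 (by simpa using this)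
  have hN : polyAt z (clearedSum X 1 0 m) =
      polyAt z (evenProd X 1 0 m) ^ 2 * ∑ k ∈ range (m + 1), c k := by
    refine Subtype.ext ?_
    have h := clearedSum_one_zero (m := m) (q := (RatFunc.X : RatFunc ℚ))
      fun i _ => ratFunc_one_sub_X_pow_ne_zero (2 * i + 1)
    rw [Subring.coe_mul, Subring.coe_pow, coe_polyAt, coe_polyAt, map_clearedSum, map_evenProd,
      map_one, map_zero, RatFunc.algebraMap_X, h, AddSubmonoidClass.coe_finsetSum]
    simp_rw [hc, cTerm_eq]
  rw [← (hD.pow 2).dvd_mul_left, ← map_pow]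
  have h := map_dvd (polyAt z) (cyclotomic_cube_dvd m hm)
  rw [map_sub, map_mul, map_mul, hN] at h
  convert h using 1
  simp only [map_pow]
  ring

/-- Modulo Φ⁴ the terms form a single block with vanishing second half, so the double sum is a
square. -/
theorem cyclotomic_pow_four_dvd_sum_conv (hz : IsPrimitiveRoot z (2 * m + 1)) (hm : 0 < m)
    {c : ℕ → regularAt z} (hc : ∀ k, (c k : RatFunc ℚ) = cTerm k)
    (hc' : ∀ k, m < k → k ≤ 2 * m → polyAt z (cyclotomic (2 * m + 1) ℚ) ^ 4 ∣ c k) :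
    polyAt z (cyclotomic (2 * m + 1) ℚ) ^ 4 ∣
      polyAt z X ^ (2 * m) *
        (∑ k ∈ range (2 * m + 1), ∑ j ∈ range (k + 1), c j * c (k - j)) -
        polyAt z (qInteger X (2 * m + 1)) ^ 2 := by
  set Φ := polyAt z (cyclotomic (2 * m + 1) ℚ)
  have h1 : Φ ^ 4 ∣ (∑ k ∈ range (2 * m + 1), ∑ j ∈ range (k + 1), c j * c (k - j)) -
      (∑ k ∈ range (m + 1), c k) ^ 2 := by
    rw [← Ideal.mem_span_singleton, ← Ideal.Quotient.eq]
    have hv : ∀ k, m < k → k < 2 * m + 1 → Ideal.Quotient.mk (Ideal.span {Φ ^ 4}) (c k) = 0 :=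
      fun k hk hk' => Ideal.Quotient.eq_zero_iff_mem.2
        (Ideal.mem_span_singleton.2 (hc' k hk (by omega)))
    have h := sum_conv_of_block (fun k => Ideal.Quotient.mk (Ideal.span {Φ ^ 4}) (c k))
      (fun _ => 1) (fun k => Ideal.Quotient.mk (Ideal.span {Φ ^ 4}) (c k)) m 1
      (fun a ha b _ => by rw [Nat.lt_one_iff.1 ha]; simp) hv
    simp only [one_mul, sum_range_one, zero_add] at h
    simp only [map_sum, map_mul, map_pow]
    rw [h]
    congr 1
    refine (sum_subset (range_subset_range.2 (by omega)) fun k hk hk' => ?_).symm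
    rw [mem_range] at hk hk'
    exact hv k (by omega) hk
  have h2 := cyclotomic_cube_dvd_sum hz hm hc
  have h3 : Φ ∣ polyAt z (qInteger X (2 * m + 1)) :=
    map_dvd _ (cyclotomic_dvd_qInteger (by omega))
  have h4 : Φ ∣ polyAt z X ^ m * (∑ k ∈ range (m + 1), c k) + polyAt z (qInteger X (2 * m + 1)) := by
    have := ((dvd_pow_self Φ three_ne_zero).trans h2).add (h3.mul_left 2)
    convert this using 1
    ring
  -- Difference of squares: x - y is divisible by Φ³ and x + y by Φ.
  have h5 := (h1.mul_left (polyAt z X ^ (2 * m))).add ((pow_succ Φ 3).symm ▸ mul_dvd_mul h2 h4)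
  convert h5 using 1
  ring

end RootOfUnity

/-! ### Assembly over the divisors of n. -/

theorem qInteger_mul_cyclotomic_cube {n : ℕ} (hn : 1 < n) :
    qInteger X n * cyclotomic n ℚ ^ 3 =
      ∏ d ∈ n.divisors.erase 1, cyclotomic d ℚ ^ (if d = n then 4 else 1) := by
  have hmem : n ∈ n.divisors.erase 1 := by simp; omega
  rw [qInteger, ← prod_cyclotomic_eq_geom_sum (by omega), ← mul_prod_erase _ _ hmem,
    ← mul_prod_erase _ (fun d => cyclotomic d ℚ ^ (if d = n then 4 else 1)) hmem, if_pos rfl]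
  have : ∏ d ∈ (n.divisors.erase 1).erase n, cyclotomic d ℚ ^ (if d = n then 4 else 1) =
      ∏ d ∈ (n.divisors.erase 1).erase n, cyclotomic d ℚ :=
    prod_congr rfl fun d hd => by rw [if_neg (ne_of_mem_erase hd), pow_one]
  rw [this]
  ring

theorem theorem4 (n : ℕ) (hn : Odd n) :
    RatFuncCongr (qInteger Polynomial.X n * Polynomial.cyclotomic n ℚ ^ 3)
      (∑ k ∈ Finset.range n, ∑ j ∈ Finset.range (k + 1), cTerm j * cTerm (k - j))
      ((RatFunc.X : RatFunc ℚ) ^ (1 - (n : ℤ)) * qInteger RatFunc.X n ^ 2) := by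
  rcases Nat.lt_or_ge 1 n with hn1 | hn1
  swap
  · have : n = 1 := by have := hn.pos; omega
    subst this
    simp [RatFuncCongr, cTerm, qInteger, qShiftedFactorial]
  rw [RatFuncCongr, qInteger_mul_cyclotomic_cube hn1]
  refine Finset.prod_dvd_of_coprime (fun d _ e _ hde =>
    (cyclotomic.isCoprime_rat hde).pow) fun d hd => ?_
  obtain ⟨hd1, hdn⟩ : d ≠ 1 ∧ d ∣ n := by
    simp only [mem_erase, Nat.mem_divisors] at hd
    exact ⟨hd.1, hd.2.1⟩
  obtain ⟨m, rfl⟩ : Odd d := hn.of_dvd_nat hdn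
  have hm : 0 < m := by omega
  have hz := Complex.isPrimitiveRoot_exp (2 * m + 1) (by omega)
  generalize Complex.exp (2 * Real.pi * Complex.I / ((2 * m + 1 : ℕ) : ℂ)) = z at hz
  obtain ⟨c, w, hc, hcw, hc'⟩ := exists_cTerm_regularAt hz hm
  have hX : IsUnit (polyAt z X) := isUnit_polyAt (by
    rw [aeval_X]; exact hz.ne_zero (by omega))
  -- `u` represents q^(1-n) in the local ring, where q is a unit because z ≠ 0.
  obtain ⟨u, hu⟩ := (hX.pow (n - 1)).exists_right_inv
  have hS : (∑ k ∈ Finset.range n, ∑ j ∈ Finset.range (k + 1), cTerm j * cTerm (k - j)) -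
      (RatFunc.X : RatFunc ℚ) ^ (1 - (n : ℤ)) * qInteger RatFunc.X n ^ 2 =
      (((∑ k ∈ Finset.range n, ∑ j ∈ Finset.range (k + 1), c j * c (k - j)) -
        u * polyAt z (qInteger X n) ^ 2 : regularAt z) : RatFunc ℚ) := by
    have hu' : (u : RatFunc ℚ) = (RatFunc.X : RatFunc ℚ) ^ (1 - (n : ℤ)) := by
      have h := congrArg Subtype.val hu
      rw [Subring.coe_mul, Subring.coe_pow, coe_polyAt, RatFunc.algebraMap_X, Subring.coe_one] at h
      rw [eq_inv_of_mul_eq_one_right h, ← zpow_natCast, ← zpow_neg]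
      congr 1
      omega
    rw [AddSubgroupClass.coe_sub, Subring.coe_mul, Subring.coe_pow, coe_polyAt, hu', map_qInteger,
      RatFunc.algebraMap_X]
    simp only [AddSubmonoidClass.coe_finsetSum, Subring.coe_mul, hc]
  rw [hS]
  split_ifs with hdn'
  · subst hdn'
    refine cyclotomic_pow_dvd_num hz (by omega) ?_
    have h := cyclotomic_pow_four_dvd_sum_conv hz hm hc hc'
    rw [← (hX.pow (2 * m)).dvd_mul_left]
    convert h using 1
    rw [Nat.add_sub_cancel] at hu
    linear_combination -(polyAt z (qInteger X (2 * m + 1)) ^ 2) * hu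
  · rw [pow_one]
    refine cyclotomic_dvd_num hz (by omega) ?_
    obtain ⟨M, rfl⟩ := hdn
    have h0 : evalAt z (polyAt z (qInteger X ((2 * m + 1) * M))) = 0 := by
      rw [evalAt_polyAt]
      refine (map_qInteger (aeval z : ℚ[X] →ₐ[ℚ] ℂ).toRingHom X _).trans ?_
      refine qInteger_eq_zero_of_pow_eq_one ?_ ?_
      · simpa using hz.ne_one (by omega)
      · simp [pow_mul, hz.pow_eq_one]
    rw [map_sub, map_mul, map_pow, h0, mul_comm (2 * m + 1) M, evalAt_sum_conv_eq_zero hz hm hcw]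
    ring
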